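/- All faces below are nonempty. Let $P\subset\mathbb R^e$ be a $d$-polytope (the convex hull of finitely many points, at least one, with affine hull of dimension $d\ge 0$). A \emph{pointed triangulation} of $P$ is a finite geometric simplicial complex $\mathcal C_P$ with underlying set $P$, together with a choice of a vertex $v_F$ of $F$ (the \emph{apex} of $F$) for every face $F$ of $P$ (including $F=P$), such that, writing $\mathcal C_F=\{\sigma\in\mathcal C_P:\sigma\subseteq F\}$: (1) for every $k$ and every $k$-face $F$ of $P$, every simplex of $\mathcal C_F$ is a face of a $k$-simplex of $\mathcal C_F$, and $v_F$ lies in every $k$-simplex of $\mathcal C_F$; (2) if $F_1,F_2$ are faces of $P$ with $v_{F_1},v_{F_2}\in F_1\cap F_2$, then $v_{F_1}=v_{F_2}$; (3) for every face $F$ of $P$ and every vertex $w\neq v_F$ of $F$, the edge $\operatorname{conv}\{v_F,w\}$ belongs to $\mathcal C_F$. The \emph{polytope numbers} $P(n)$ and \emph{interior polytope numbers} $P(n)^\sharp$, $n\ge 0$, with respect to the apexes $v_F$ are defined by recursion on the dimension and on $n$, simultaneously for all faces. If $\dim P=0$, then $P(0)=P(0)^\sharp=0$ and $P(n)=P(n)^\sharp=1$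 for $n\ge1$. If $\dim P\ge 1$, then $P(0)=0$, $P(1)=1$, $P(0)^\sharp=P(1)^\sharp=0$, and for $n\ge2$ $$P(n)=P(n-1)+\sum_{F\text{ face of }P,\ v_P\notin F}F(n)^\sharp,\qquad P(n)^\sharp=P(n)-\sum_{F\text{ face of }P,\ F\ne P}F(n)^\sharp .$$ For a $k$-simplex $\alpha$, $k\ge 0$, with vertices $u_1,\dots,u_{k+1}$ let $$S_\alpha(n)=\Big\{\sum_{i=1}^{k+1}x_iu_i : x\in\mathbb N^{k+1},\ \sum_{i=1}^{k+1} x_i=n-1\Big\},\qquad \mathbb N=\{0,1,2,\dots\},$$ which is the image of $\{x\in\mathbb N^{k+1}:\sum_i x_i=n-1\}$ under the linear map $e_i\mapsto u_i$, and is empty for $n=0$. Let $\partial P$ be the set of points of $P$ that lie in a proper face of $P$. \textbf{Theorem.} Let $P$ be a $d$-polytope with a pointed triangulation $\mathcal C_P$, and let $P(n)$ and $P(n)^\sharp$ be the polytope numbers and interior polytope numbers with respect to its apexes. Then for every $n\ge0$ the sets below are finite and $$P(n)=\Big|\bigcup_{\alpha}S_{\alpha}(n)\Big|,\qquad P(n)^\sharp=\Big|\Big(\bigcup_{\alpha}S_{\alpha}(n)\Big)\setminus\Big(\bigcup_{\beta}S_{\beta}(n)\Big)\Big|,$$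 where $\alpha$ runs over the $d$-simplices of $\mathcal C_P$ and $\beta$ over the $(d-1)$-simplices of $\mathcal C_P$ contained in $\partial P$ (there are no $\beta$ when $d=0$). -/

import Mathlib

noncomputable section

namespace PolytopeNumbers

variable {E : Type*} [NormedAddCommGroup E] [NormedSpace ℝ E]

/-- The dimension of (the affine hull of) a set. -/
def dim (P : Set E) : ℕ := Module.finrank ℝ (vectorSpan ℝ P)

/-- `P` is a `d`-polytope: the convex hull of a finite nonempty set of points, of dimension `d`. -/
def IsPolytope (d : ℕ) (P : Set E) : Prop :=
  (∃ t : Finset E, t.Nonempty ∧ P = convexHull ℝ (t : Set E)) ∧ dim P = d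

/-- `F` is a nonempty face of `P` (the set where some linear functional is maximal on `P`;
`F = P` is allowed). The empty face has no apex and is never used. -/
def IsFace (P F : Set E) : Prop := F.Nonempty ∧ IsExposed ℝ P F

/-- `F` is a nonempty proper face of `P`. -/
def IsProperFace (P F : Set E) : Prop := IsFace P F ∧ F ≠ P

/-- The vertices of `P`: the points `x` such that `{x}` is a face. -/
def vert (P : Set E) : Set E := {x | IsFace P {x}}

/-- The boundary of `P`: the points of `P` that lie in some proper face. -/
def boundary (P : Set E) : Set E := {x | x ∈ P ∧ ∃ F, IsProperFace P F ∧ x ∈ F}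

theorem IsProperFace.dim_lt [FiniteDimensional ℝ E] {P F : Set E} (h : IsProperFace P F) :
    dim F < dim P := by
  obtain ⟨⟨hne, hexp⟩, hFP⟩ := h
  have hsub : F ⊆ P := hexp.subset
  obtain ⟨l, hl⟩ := hexp hne
  obtain ⟨x, hx⟩ := hne
  obtain ⟨y, hyP, hyF⟩ : ∃ y ∈ P, y ∉ F := by
    by_contra! hc
    exact hFP (hsub.antisymm hc)
  have hker : vectorSpan ℝ F ≤ LinearMap.ker (l : E →ₗ[ℝ] ℝ) := by
    rw [vectorSpan, Submodule.span_le]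
    rintro _ ⟨a, ha, b, hb, rfl⟩
    rw [hl] at ha hb
    have := le_antisymm (ha.2 b hb.1) (hb.2 a ha.1)
    simp [this]
  apply Submodule.finrank_lt_finrank_of_lt
  refine lt_of_le_of_ne (vectorSpan_mono ℝ hsub) fun heq => ?_
  have hyx : y - x ∈ vectorSpan ℝ F := by
    rw [heq]
    exact vsub_mem_vectorSpan ℝ hyP (hsub hx)
  have h0 : l y = l x := by
    have := hker hyx
    simpa [sub_eq_zero] using this
  apply hyF
  rw [hl] at hx ⊢
  exact ⟨hyP, fun z hz => h0 ▸ hx.2 z hz⟩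

/- The polytope numbers `P(n)` and the interior polytope numbers `P(n)^♯` with respect to a choice
`v` of a vertex `v F` of every face `F`, by double recursion on the dimension and on `n`.
In the sum for `P(n)` the requirement `F ≠ P` is implied by `v P ∉ F` whenever `v P ∈ P`. -/
mutual

/-- The `v`-polytope numbers `P(n)`. -/
def polytopeNumber [FiniteDimensional ℝ E] (v : Set E → E) (P : Set E) (n : ℕ) : ℤ :=
  match n with
  | 0 => 0
  | 1 => 1
  | n + 2 =>
    if dim P = 0 then 1
    else polytopeNumber v P (n + 1) +
      ∑ᶠ F : {F : Set E // IsProperFace P F ∧ v P ∉ F},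
        interiorPolytopeNumber v F.1 (n + 2)
termination_by (dim P, n, 0)
decreasing_by
  · decreasing_tactic
  · exact Prod.Lex.left _ _ F.2.1.dim_lt

/-- The interior `v`-polytope numbers `P(n)^♯`. -/
def interiorPolytopeNumber [FiniteDimensional ℝ E] (v : Set E → E) (P : Set E) (n : ℕ) : ℤ :=
  match n with
  | 0 => 0
  | 1 => if dim P = 0 then 1 else 0
  | n + 2 =>
    if dim P = 0 then 1
    else polytopeNumber v P (n + 2) -
      ∑ᶠ F : {F : Set E // IsProperFace P F}, interiorPolytopeNumber v F.1 (n + 2)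
termination_by (dim P, n, 1)
decreasing_by
  · decreasing_tactic
  · exact Prod.Lex.left _ _ F.2.dim_lt

end

/-- The set of `k`-simplices of `K` that are contained in `A`, each given by its vertex set. For a
face `F` of a polytope triangulated by `K`, the simplices of `K` contained in `F` form the induced
triangulation of `F`. -/
def simplicesIn (K : Geometry.SimplicialComplex ℝ E) (A : Set E) (k : ℕ) : Set (Finset E) :=
  {s | s ∈ K.faces ∧ convexHull ℝ (s : Set E) ⊆ A ∧ s.card = k + 1}

/-- `K` is a pointed triangulation of `P` with apexes `v F`, `F` a face of `P`. -/
structure IsPointedTriangulation (P : Set E) (K : Geometry.SimplicialComplex ℝ E)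
    (v : Set E → E) : Prop where
  finite_faces : K.faces.Finite
  space_eq : K.space = P
  /-- The triangulation of a `k`-face `F` induced by `K` is generated by its `k`-simplices. -/
  pure_face : ∀ F, IsFace P F → ∀ s ∈ K.faces, convexHull ℝ (s : Set E) ⊆ F →
    ∃ t ∈ simplicesIn K F (dim F), s ⊆ t
  apex_vert : ∀ F, IsFace P F → v F ∈ vert F
  /-- The apex of a `k`-face lies in all `k`-simplices of the triangulation of this face. -/
  apex_mem : ∀ F, IsFace P F → ∀ s ∈ simplicesIn K F (dim F), v F ∈ convexHull ℝ (s : Set E)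
  apex_eq : ∀ F₁ F₂, IsFace P F₁ → IsFace P F₂ → {v F₁, v F₂} ⊆ F₁ ∩ F₂ → v F₁ = v F₂
  /-- The apex of a face is joined by an edge of the triangulation to all its other vertices. -/
  edge_mem : ∀ F, IsFace P F → ∀ w ∈ vert F, w ≠ v F →
    ∃ s ∈ K.faces, (s : Set E) = {v F, w}

/-- The points of the standard simplex: `{x ∈ ℕ^ι | ∑ x = n - 1}`, empty for `n = 0`. -/
def standardPoints (ι : Type*) [Fintype ι] (n : ℕ) : Set (ι → ℕ) :=
  {x | ((∑ i, x i : ℕ) : ℤ) = (n : ℤ) - 1}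

/-- The point set `S_α(n)` of the simplex `α` with vertex set `s`: the image of the points of the
standard simplex under the map that sends the unit vector at `u ∈ s` to the vertex `u`. -/
def pointSet (s : Finset E) (n : ℕ) : Set E :=
  (fun x : s → ℕ => ∑ u, (x u : ℝ) • (u : E)) '' standardPoints s n

/-- `S_P(n)`: the union of the point sets of the `d`-simplices of the triangulation. -/
def unionPoints (d : ℕ) (K : Geometry.SimplicialComplex ℝ E) (n : ℕ) : Set E :=
  ⋃ s ∈ {s | s ∈ K.faces ∧ s.card = d + 1}, pointSet s n

/-- The union of the point sets of the `(d-1)`-simplices of the triangulation in the boundary of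
`P`. A `(d-1)`-simplex has `d` vertices; faces of `K` are nonempty, so there is none for `d = 0`. -/
def boundaryPoints (d : ℕ) (P : Set E) (K : Geometry.SimplicialComplex ℝ E) (n : ℕ) : Set E :=
  ⋃ s ∈ {s | s ∈ K.faces ∧ s.card = d ∧ convexHull ℝ (s : Set E) ⊆ boundary P}, pointSet s n

end PolytopeNumbers

end

-- A point of `S_α(n)` with `n = m + 1` is the sum of a multiset of `m` vertices of `α`. Divided by
-- `m > 0`, the multiplicities are barycentric coordinates, and these are unique throughout the
-- complex (`weight_eq_of_mem_faces`). So summation is injective on multisets supported on simplices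
-- (`sum_injOn_supported`), and the theorem reduces to counting multisets. It remains to see that
-- these counts obey the defining recursions.
--
-- Each nonempty supported multiset in a face `F` has a unique smallest face of `F` containing its
-- support; sorting by that face gives the recursion for interior numbers
-- (`ncard_innerSupported_succ`).
--
-- For `P(n)`, split by whether the multiset contains the apex `v F` (`ncard_supported_succ`).
-- Adding a copy of `v F` is a bijection from size `m` onto the multisets of size `m + 1` containing
-- it, since every simplex in `F` extends to a top-dimensional one, which has `v F` as a vertex. If
-- `v F` is absent and `G` is the smallest face, then `v F ∉ G`: otherwise `apex_eq` gives `v F = v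
-- G`, so the support misses the apex of `G` and lies in a proper face of `G`
-- (`exists_isProperFace`), against minimality.
--
-- Finally, purity replaces arbitrary simplices by `d`-simplices, and purity on facets does the same
-- for the boundary (`unionPoints_succ`, `boundaryPoints_succ`).

noncomputable section

namespace PolytopeNumbers

variable {E : Type*} [NormedAddCommGroup E] [NormedSpace ℝ E]

/-! ### Faces of polytopes -/

/-- If a convex combination of points of `P` lies in a face `F`, so do the points that occur. -/
theorem IsFace.mem_of_sum_mem {P F : Set E} (hF : IsFace P F) {s : Finset E}
    (hs : (s : Set E) ⊆ P) {w : E → ℝ} (hw₀ : ∀ u ∈ s, 0 ≤ w u) (hw₁ : ∑ u ∈ s, w u = 1)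
    (hmem : ∑ u ∈ s, w u • u ∈ F) {u : E} (hu : u ∈ s) (hwu : w u ≠ 0) : u ∈ F := by
  obtain ⟨l, hl⟩ := hF.2 hF.1
  set p := ∑ u ∈ s, w u • u with hp
  rw [hl] at hmem ⊢
  -- The gaps `l p - l y` are nonnegative because `p` maximizes `l`, and their weighted mean is
  -- zero; so a gap of nonzero weight vanishes.
  have hsum : ∑ y ∈ s, w y * (l p - l y) = 0 := by
    simp only [mul_sub, Finset.sum_sub_distrib, ← Finset.sum_mul, hw₁, one_mul]
    rw [hp, map_sum]
    simp
  have hz := (Finset.sum_eq_zero_iff_of_nonneg fun y hy =>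
    mul_nonneg (hw₀ y hy) (sub_nonneg.2 (hmem.2 y (hs hy)))).1 hsum u hu
  have hlu : l u = l p := by
    rcases mul_eq_zero.1 hz with h | h
    · exact absurd h hwu
    · linarith
  exact ⟨hs hu, fun y hy => hlu ▸ hmem.2 y hy⟩

/-- Every nonempty finite set of points of `P` whose centroid lies in a face is contained in it. -/
theorem IsFace.subset_of_centroid_mem {P F : Set E} (hF : IsFace P F) {s : Finset E}
    (hs : (s : Set E) ⊆ P) (hne : s.Nonempty)
    (hmem : ∑ u ∈ s, (s.card : ℝ)⁻¹ • u ∈ F) : (s : Set E) ⊆ F := by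
  have hc : (s.card : ℝ) ≠ 0 := by simpa using hne.ne_empty
  intro u hu
  exact hF.mem_of_sum_mem hs (w := fun _ => (s.card : ℝ)⁻¹) (fun _ _ => by positivity)
    (by simp [hc]) hmem hu (inv_ne_zero hc)

/-- The centroid of a nonempty finite set lies in its convex hull. -/
theorem centroid_mem_convexHull {s : Finset E} (hne : s.Nonempty) :
    ∑ u ∈ s, (s.card : ℝ)⁻¹ • u ∈ convexHull ℝ (s : Set E) := by
  have hc : (s.card : ℝ) ≠ 0 := by simpa using hne.ne_empty
  exact Finset.mem_convexHull'.2
    ⟨fun _ => (s.card : ℝ)⁻¹, fun _ _ => by positivity, by simp [hc], rfl⟩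

theorem IsFace.subset {P F : Set E} (hF : IsFace P F) : F ⊆ P := hF.2.subset

theorem IsFace.convex {P F : Set E} (hF : IsFace P F) (hP : Convex ℝ P) : Convex ℝ F :=
  hF.2.convex hP

theorem IsFace.refl {P : Set E} (hP : P.Nonempty) : IsFace P P := ⟨hP, .refl P⟩

/-- A face of `P` contained in a face `F` of `P` is a face of `F`. -/
theorem IsFace.mono {P F G : Set E} (hG : IsFace P G) (hFP : F ⊆ P) (hGF : G ⊆ F) : IsFace F G :=
  ⟨hG.1, hG.2.mono hFP hGF⟩

/-- Every convex combination of generators landing in `F` uses only generators in `F`. Faces can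
therefore be compared through their generators. -/
theorem IsFace.eq_convexHull_inter {t : Finset E} {F : Set E}
    (hF : IsFace (convexHull ℝ (t : Set E)) F) : F = convexHull ℝ ((t : Set E) ∩ F) := by
  classical
  refine Set.Subset.antisymm (fun x hx => ?_)
    (convexHull_min Set.inter_subset_right (hF.convex (convex_convexHull ℝ _)))
  obtain ⟨w, hw₀, hw₁, rfl⟩ := Finset.mem_convexHull'.1 (hF.subset hx)
  have hsupp : ∀ u ∈ t, w u ≠ 0 → u ∈ F := fun u hu hwu =>
    hF.mem_of_sum_mem (subset_convexHull ℝ _) hw₀ hw₁ hx hu hwu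
  rw [← Finset.sum_filter_of_ne (p := fun u => w u ≠ 0)
    (fun u _ h h0 => h (by rw [h0, zero_smul]))]
  refine (convex_convexHull ℝ _).sum_mem (fun u hu => hw₀ u (Finset.mem_filter.1 hu).1) ?_
    fun u hu => subset_convexHull ℝ _ ?_
  · rw [Finset.sum_filter_of_ne (fun u _ h => h), hw₁]
  · rw [Finset.mem_filter] at hu
    exact ⟨hu.1, hsupp u hu.1 hu.2⟩

/-- A polytope has finitely many faces. -/
theorem finite_setOf_isFace (t : Finset E) :
    {F | IsFace (convexHull ℝ (t : Set E)) F}.Finite := by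
  refine ((t.finite_toSet.finite_subsets).image (convexHull ℝ)).subset fun F hF => ?_
  exact ⟨(t : Set E) ∩ F, Set.inter_subset_left, (IsFace.eq_convexHull_inter hF).symm⟩

theorem le_of_mem_convexHull {A : Set E} {φ : StrongDual ℝ E} {M : ℝ}
    (h : ∀ w ∈ A, φ w ≤ M) {x : E} (hx : x ∈ convexHull ℝ A) : φ x ≤ M :=
  convexHull_min (t := {x | φ x ≤ M}) h (convex_halfSpace_le φ.toLinearMap.isLinear M) hx

/-- A linear functional bounded by `M` on the generators of a polytope and attaining `M` at one of
them cuts out a face. -/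
theorem isFace_setOf_eq {A : Set E} {φ : StrongDual ℝ E} {M : ℝ}
    (h : ∀ w ∈ A, φ w ≤ M) {w : E} (hw : w ∈ A) (hwM : φ w = M) :
    IsFace (convexHull ℝ A) {x ∈ convexHull ℝ A | φ x = M} := by
  refine ⟨⟨w, subset_convexHull ℝ _ hw, hwM⟩, fun _ => ⟨φ, ?_⟩⟩
  ext x
  refine and_congr_right fun hx => ⟨fun h' y hy => h' ▸ le_of_mem_convexHull h hy, fun h' => ?_⟩
  exact le_antisymm (le_of_mem_convexHull h hx) (hwM ▸ h' w (subset_convexHull ℝ _ hw))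

theorem IsFace.exists_functional {P F : Set E} (hF : IsFace P F) :
    ∃ (φ : StrongDual ℝ E) (M : ℝ), (∀ x ∈ P, φ x ≤ M) ∧ F = {x ∈ P | φ x = M} := by
  obtain ⟨φ, hφ⟩ := hF.2 hF.1
  obtain ⟨p, hp⟩ := hF.1
  rw [hφ] at hp
  refine ⟨φ, φ p, hp.2, ?_⟩
  rw [hφ]
  ext x
  exact and_congr_right fun hx =>
    ⟨fun h => le_antisymm (hp.2 x hx) (h p hp.1), fun h y hy => h ▸ hp.2 y hy⟩

/-- A face of a face of a polytope is a face of the polytope. -/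
theorem IsFace.trans {t : Finset E} {F G : Set E} (hF : IsFace (convexHull ℝ (t : Set E)) F)
    (hG : IsFace F G) : IsFace (convexHull ℝ (t : Set E)) G := by
  classical
  obtain ⟨φ, M, hφ, hFeq⟩ := hF.exists_functional
  obtain ⟨ψ, M', hψ, hGeq⟩ := hG.exists_functional
  -- The functional `(N + 1) • φ + ψ` will expose `G`: this `N` makes `φ` dominate, so that
  -- generators off `F` stay strictly below the maximum.
  obtain ⟨N, hN⟩ := (t.image fun w => (ψ w - M') / (M - φ w)).exists_le
  have htP : ∀ w ∈ t, w ∈ convexHull ℝ (t : Set E) := fun w hw => subset_convexHull ℝ _ hw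
  have hbound : ∀ w ∈ t, w ∉ F → ((N + 1) • φ + ψ) w < (N + 1) * M + M' := by
    intro w hw hwF
    have hlt : φ w < M := lt_of_le_of_ne (hφ w (htP w hw)) fun h =>
      hwF (hFeq ▸ ⟨htP w hw, h⟩)
    have h1 := hN _ (Finset.mem_image_of_mem _ hw)
    rw [div_le_iff₀ (sub_pos.2 hlt)] at h1
    simp only [add_apply, smul_apply, smul_eq_mul]
    nlinarith
  have hval : ∀ w ∈ F, ((N + 1) • φ + ψ) w = (N + 1) * M + ψ w := by
    intro w hw
    rw [hFeq] at hw
    simp [hw.2]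
  have hle : ∀ w ∈ (t : Set E), ((N + 1) • φ + ψ) w ≤ (N + 1) * M + M' := by
    intro w hw
    by_cases hwF : w ∈ F
    · rw [hval w hwF]
      linarith [hψ w hwF]
    · exact (hbound w hw hwF).le
  have hiff : ∀ w ∈ t, (((N + 1) • φ + ψ) w = (N + 1) * M + M' ↔ w ∈ G) := by
    intro w hw
    by_cases hwF : w ∈ F
    · rw [hval w hwF, hGeq]
      simp [hwF]
    · exact iff_of_false (hbound w hw hwF).ne fun h => hwF (hG.subset h)
  have hGt : G = convexHull ℝ ((t : Set E) ∩ G) := by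
    refine Set.Subset.antisymm ?_
      (convexHull_min Set.inter_subset_right (hG.convex (hF.convex (convex_convexHull ℝ _))))
    have hF' : F = convexHull ℝ ((t.filter (· ∈ F) : Finset E) : Set E) := by
      rw [Finset.coe_filter]
      exact hF.eq_convexHull_inter
    have hG' := hG
    rw [hF'] at hG'
    have := hG'.eq_convexHull_inter
    refine this.subset.trans (convexHull_mono ?_)
    simp only [Finset.coe_filter]
    exact fun x hx => ⟨hx.1.1, hx.2⟩
  have hne : ((t : Set E) ∩ G).Nonempty := convexHull_nonempty_iff.1 (hGt ▸ hG.1)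
  obtain ⟨w, hwt, hwG⟩ := hne
  have hface := isFace_setOf_eq hle hwt ((hiff w hwt).2 hwG)
  have : {x ∈ convexHull ℝ (t : Set E) | ((N + 1) • φ + ψ) x = (N + 1) * M + M'} = G := by
    rw [hface.eq_convexHull_inter, hGt]
    congr 1
    ext x
    exact and_congr_right fun hx =>
      ⟨fun h => (hiff x hx).1 h.2, fun h => ⟨htP x hx, (hiff x hx).2 h⟩⟩
  exact this ▸ hface

/-- Two faces of a polytope that meet do so in a face. -/
theorem IsFace.inter {P F G : Set E} (hF : IsFace P F) (hG : IsFace P G)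
    (hne : (F ∩ G).Nonempty) : IsFace P (F ∩ G) :=
  ⟨hne, hF.2.inter hG.2⟩

-- Facets, and prolongation of segments

section FiniteDimensional

variable [FiniteDimensional ℝ E]

/-- A proper face of dimension less than `d - 1` of a `d`-polytope is contained in a larger proper
face. -/
theorem IsProperFace.exists_ssuperset {t : Finset E} {F : Set E}
    (hF : IsProperFace (convexHull ℝ (t : Set E)) F)
    (hdim : dim F + 1 < dim (convexHull ℝ (t : Set E))) :
    ∃ G, IsProperFace (convexHull ℝ (t : Set E)) G ∧ F ⊂ G := by
  classical
  set P := convexHull ℝ (t : Set E) with hPdef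
  obtain ⟨φ, M, hφ, hFeq⟩ := hF.1.exists_functional
  obtain ⟨p, hp⟩ := hF.1.1
  have htP : ∀ w ∈ t, w ∈ P := fun w hw => subset_convexHull ℝ _ hw
  -- a direction of `P` in the kernel of `φ`, but not parallel to `F`
  obtain ⟨u, ⟨huP, huφ⟩, huF⟩ : ∃ u ∈ vectorSpan ℝ P ⊓ LinearMap.ker φ.toLinearMap,
      u ∉ vectorSpan ℝ F := by
    by_contra! hc
    have h1 : Module.finrank ℝ ↥(vectorSpan ℝ P ⊓ LinearMap.ker φ.toLinearMap) ≤ dim F :=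
      Submodule.finrank_mono hc
    have h2 := LinearMap.finrank_range_add_finrank_ker (φ.toLinearMap.domRestrict (vectorSpan ℝ P))
    have h3 : Module.finrank ℝ (LinearMap.range (φ.toLinearMap.domRestrict (vectorSpan ℝ P))) ≤ 1 :=
      (Submodule.finrank_le _).trans (Module.finrank_self ℝ).le
    have h4 : Module.finrank ℝ (LinearMap.ker (φ.toLinearMap.domRestrict (vectorSpan ℝ P))) =
        Module.finrank ℝ ↥(vectorSpan ℝ P ⊓ LinearMap.ker φ.toLinearMap) := by
      rw [LinearMap.ker_domRestrict, ← Submodule.map_comap_subtype]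
      exact (LinearEquiv.finrank_eq (Submodule.equivMapOfInjective _
        (Submodule.subtype_injective _) _))
    unfold dim at *
    omega
  -- Tilting `φ` by a functional constant on `F` turns the supporting hyperplane about `F`. Since `φ
  -- u = 0` and `g₀ u ≠ 0`, the tilted functional is still not constant on `P`.
  obtain ⟨g₀, hg₀u, hg₀F⟩ := Submodule.exists_le_ker_of_notMem huF
  have hnc : ∀ h : E →ₗ[ℝ] ℝ, h u ≠ 0 → ∀ c, ∃ w ∈ t, h w ≠ c := by
    intro h hu c
    by_contra! hc
    refine hu (?_ : u ∈ LinearMap.ker h)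
    have huP' : u ∈ vectorSpan ℝ (t : Set E) := by
      rw [← direction_affineSpan, ← affineSpan_convexHull, direction_affineSpan]
      exact huP
    refine (Submodule.span_le (p := LinearMap.ker h)).2 ?_ huP'
    rintro _ ⟨a, ha, b, hb, rfl⟩
    simp [hc a ha, hc b hb]
  obtain ⟨g, hgu, hgF, w₁, hw₁t, hw₁⟩ : ∃ g : E →ₗ[ℝ] ℝ, g u ≠ 0 ∧
      vectorSpan ℝ F ≤ LinearMap.ker g ∧ ∃ w ∈ t, g p < g w := by
    obtain ⟨w, hwt, hw⟩ := hnc g₀ hg₀u (g₀ p)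
    rcases lt_or_gt_of_ne hw with h | h
    · exact ⟨-g₀, by simpa using hg₀u, fun x hx => by simpa using hg₀F hx, w, hwt, by simpa using h⟩
    · exact ⟨g₀, hg₀u, hg₀F, w, hwt, h⟩
  have hgc : ∀ x ∈ F, g x = g p := by
    intro x hx
    have := hgF (vsub_mem_vectorSpan ℝ hx hp)
    simpa [sub_eq_zero] using this
  have hlt : ∀ w ∈ t, g p < g w → φ w < M := by
    intro w hw hgw
    refine lt_of_le_of_ne (hφ w (htP w hw)) fun h => ?_
    exact hgw.ne' (hgc w (hFeq ▸ ⟨htP w hw, h⟩))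
  -- The least ratio is the tilt `τ` at which the turning hyperplane first meets a generator outside
  -- `F`; that generator `w₀` makes the new face strictly larger.
  obtain ⟨w₀, hw₀, hmin⟩ := (t.filter fun w => g p < g w).exists_min_image
    (fun w => (M - φ w) / (g w - g p)) ⟨w₁, Finset.mem_filter.2 ⟨hw₁t, hw₁⟩⟩
  rw [Finset.mem_filter] at hw₀
  set τ := (M - φ w₀) / (g w₀ - g p) with hτ
  have hτpos : 0 < τ := div_pos (sub_pos.2 (hlt w₀ hw₀.1 hw₀.2)) (sub_pos.2 hw₀.2)
  set χ : StrongDual ℝ E := φ + τ • LinearMap.toContinuousLinearMap g with hχ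
  have hχv : ∀ x, χ x = φ x + τ * g x := fun x => by simp [hχ]
  have hχle : ∀ w ∈ (t : Set E), χ w ≤ M + τ * g p := by
    intro w hw
    rw [hχv]
    by_cases hgw : g p < g w
    · have := hmin w (Finset.mem_filter.2 ⟨hw, hgw⟩)
      rw [le_div_iff₀ (sub_pos.2 hgw)] at this
      linarith
    · have := hφ w (htP w hw)
      nlinarith
  have hχw₀ : χ w₀ = M + τ * g p := by
    have : τ * (g w₀ - g p) = M - φ w₀ := div_mul_cancel₀ _ (sub_pos.2 hw₀.2).ne'
    rw [hχv]
    linarith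
  refine ⟨_, ⟨isFace_setOf_eq hχle hw₀.1 hχw₀, fun hEq => ?_⟩, ?_, fun hsub => ?_⟩
  · obtain ⟨w, hwt, hw⟩ := hnc χ.toLinearMap (by
      have : φ u = 0 := huφ
      simpa [hχv, this] using ⟨hτpos.ne', hgu⟩) (M + τ * g p)
    have : w ∈ P := htP w hwt
    rw [← hEq] at this
    exact hw this.2
  · intro x hx
    refine ⟨hF.1.subset hx, ?_⟩
    rw [hχv, hgc x hx]
    rw [hFeq] at hx
    rw [hx.2]
  · have := hgc w₀ (hsub ⟨htP w₀ hw₀.1, hχw₀⟩)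
    exact hw₀.2.ne' this

/-- Every proper face of a polytope is contained in a facet. -/
theorem IsProperFace.exists_facet {t : Finset E} {F : Set E}
    (hF : IsProperFace (convexHull ℝ (t : Set E)) F) :
    ∃ G, IsProperFace (convexHull ℝ (t : Set E)) G ∧ F ⊆ G ∧
      dim G + 1 = dim (convexHull ℝ (t : Set E)) := by
  induction h : dim (convexHull ℝ (t : Set E)) - dim F using Nat.strong_induction_on
    generalizing F with
  | _ k ih =>
    have hlt := hF.dim_lt
    by_cases hd : dim F + 1 = dim (convexHull ℝ (t : Set E))
    · exact ⟨F, hF, subset_rfl, hd⟩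
    · obtain ⟨G, hG, hFG⟩ := hF.exists_ssuperset (by omega)
      have hFG' : IsProperFace G F := ⟨hF.1.mono hG.1.subset hFG.subset, hFG.ne⟩
      have := hFG'.dim_lt
      have := hG.dim_lt
      obtain ⟨G', hG', hGG', hdim⟩ := ih _ (by omega) hG rfl
      exact ⟨G', hG', hFG.subset.trans hGG', hdim⟩

/-- If a point `x` of a convex set `P` lies in no proper face, segments of `P` ending in `x` can be
prolonged within `P`. -/
theorem exists_prolongation {P : Set E} (hP : Convex ℝ P) {x y : E} (hx : x ∈ P) (hy : y ∈ P)
    (hproper : ∀ F, IsProperFace P F → x ∉ F) : ∃ ε : ℝ, 0 < ε ∧ x + ε • (x - y) ∈ P := by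
  -- Passing to the direction space with `x` as origin gives `Q` nonempty interior, and it suffices
  -- that `0` is interior to `Q`.
  set V := vectorSpan ℝ P with hV
  set Q : Set V := {u | x + (u : E) ∈ P} with hQ
  have hQc : Convex ℝ Q := by
    intro a ha b hb α β hα hβ hαβ
    have := hP ha hb hα hβ hαβ
    rw [smul_add, smul_add, add_add_add_comm, ← add_smul, hαβ, one_smul] at this
    simpa [hQ] using this
  have h0Q : (0 : V) ∈ Q := by simpa [hQ] using hx
  have hspan : affineSpan ℝ Q = ⊤ := by
    rw [AffineSubspace.affineSpan_eq_top_iff_vectorSpan_eq_top_of_nonempty ℝ V V ⟨0, h0Q⟩,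
      vectorSpan_eq_span_vsub_set_right ℝ h0Q, eq_top_iff]
    have h1 : V = Submodule.map V.subtype (Submodule.span ℝ ((fun z => z -ᵥ (0 : V)) '' Q)) := by
      rw [Submodule.map_span]
      refine (vectorSpan_eq_span_vsub_set_right ℝ hx).trans ?_
      congr 1
      ext z
      constructor
      · rintro ⟨a, ha, rfl⟩
        have haV : a - x ∈ V := vsub_mem_vectorSpan ℝ ha hx
        exact ⟨⟨a - x, haV⟩, ⟨⟨a - x, haV⟩, by simpa [hQ] using ha, by simp⟩, by simp⟩
      · rintro ⟨_, ⟨a, ha, rfl⟩, rfl⟩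
        exact ⟨x + a, ha, by simp⟩
    rintro ⟨z, hz⟩ -
    obtain ⟨z', hz', rfl⟩ := h1.le hz
    exact hz'
  have hint : (interior Q).Nonempty := (hQc.interior_nonempty_iff_affineSpan_eq_top).2 hspan
  have h0 : (0 : V) ∈ interior Q := by
    by_contra hc
    -- Otherwise a separating functional, extended to `E`, exposes a face through `x`; the face is
    -- proper because the separation is strict at interior points.
    obtain ⟨l, hl⟩ := geometric_hahn_banach_open_point hQc.interior isOpen_interior hc
    obtain ⟨L, hL, -⟩ := exists_extension_norm_eq V l
    obtain ⟨q, hq⟩ := hint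
    have hle : ∀ u ∈ Q, l u ≤ 0 := by
      intro u hu
      have : u ∈ closure (interior Q) := by
        rw [hQc.closure_interior_eq_closure_of_nonempty_interior ⟨q, hq⟩]
        exact subset_closure hu
      refine closure_minimal (s := interior Q) (t := {u | l u ≤ 0}) (fun z hz => ?_)
        (isClosed_le l.continuous continuous_const) this
      simpa using (hl z hz).le
    have hLP : ∀ z ∈ P, L z ≤ L x := by
      intro z hz
      have hzV : z - x ∈ V := vsub_mem_vectorSpan ℝ hz hx
      have h1 := hle ⟨z - x, hzV⟩ (by simpa [hQ] using hz)
      rw [← hL] at h1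
      simpa using h1
    refine hproper {z ∈ P | ∀ y ∈ P, L y ≤ L z} ⟨⟨⟨x, hx, hLP⟩, fun _ => ⟨L, rfl⟩⟩, fun hEq => ?_⟩
      ⟨hx, hLP⟩
    have hqP : x + (q : E) ∈ P := (interior_subset hq : q ∈ Q)
    rw [← hEq] at hqP
    have h1 := hqP.2 x hx
    have h2 := hl q hq
    rw [← hL, map_zero] at h2
    rw [map_add] at h1
    linarith
  have hyV : x - y ∈ V := vsub_mem_vectorSpan ℝ hx hy
  have hcont : Filter.Tendsto (fun ε : ℝ => ε • (⟨x - y, hyV⟩ : V)) (nhds 0) (nhds 0) := by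
    have : Continuous fun ε : ℝ => ε • (⟨x - y, hyV⟩ : V) := by fun_prop
    simpa using this.tendsto 0
  have hev := hcont.eventually (mem_interior_iff_mem_nhds.1 h0)
  obtain ⟨δ, hδ, hball⟩ := Metric.eventually_nhds_iff.1 hev
  refine ⟨δ / 2, by positivity, ?_⟩
  have := hball (y := δ / 2) (by rw [Real.dist_eq, sub_zero, abs_of_pos (by positivity)]; linarith)
  simpa [hQ] using this

end FiniteDimensional

/-! ### Barycentric coordinates in a simplicial complex -/

theorem weight_eq_of_affineIndependent [DecidableEq E] {s r : Finset E}
    (hs : AffineIndependent ℝ ((↑) : s → E))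
    (hr : r ⊆ s) {w y : E → ℝ} (hw : ∑ u ∈ s, w u = 1) (hy : ∑ u ∈ r, y u = 1)
    (h : ∑ u ∈ s, w u • u = ∑ u ∈ r, y u • u) {u : E} (hu : u ∈ s) :
    w u = if u ∈ r then y u else 0 := by
  have key := hs.eq_zero_of_sum_eq_zero_subtype (w := fun u => w u - if u ∈ r then y u else 0)
    (by simp [Finset.sum_sub_distrib, hw, Finset.sum_ite_mem, Finset.inter_eq_right.2 hr, hy])
    (by simp [sub_smul, Finset.sum_sub_distrib, ite_smul, Finset.sum_ite_mem,
      Finset.inter_eq_right.2 hr, h]) u hu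
  exact sub_eq_zero.1 key

/-- The barycentric coordinates of a point do not depend on the simplex of the complex that is used
to compute them. -/
theorem weight_eq_of_mem_faces [DecidableEq E] {K : Geometry.SimplicialComplex ℝ E} {s t : Finset E}
    (hs : s ∈ K.faces) (ht : t ∈ K.faces) {w z : E → ℝ}
    (hw₀ : ∀ u ∈ s, 0 ≤ w u) (hw₁ : ∑ u ∈ s, w u = 1)
    (hz₀ : ∀ u ∈ t, 0 ≤ z u) (hz₁ : ∑ u ∈ t, z u = 1)
    (h : ∑ u ∈ s, w u • u = ∑ u ∈ t, z u • u) {u : E} (hu : u ∈ s) :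
    w u = if u ∈ t then z u else 0 := by
  -- The point lies in the hull of the common vertices, so both weight families are extensions by
  -- zero of one family on `s ∩ t`.
  have hmem := K.inter_subset_convexHull hs ht
    ⟨Finset.mem_convexHull'.2 ⟨w, hw₀, hw₁, rfl⟩, Finset.mem_convexHull'.2 ⟨z, hz₀, hz₁, h.symm⟩⟩
  rw [← Finset.coe_inter] at hmem
  obtain ⟨y, -, hy₁, hy⟩ := Finset.mem_convexHull'.1 hmem
  rw [weight_eq_of_affineIndependent (K.indep hs) Finset.inter_subset_left hw₁ hy₁ hy.symm hu]
  by_cases hut : u ∈ t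
  · rw [if_pos hut, weight_eq_of_affineIndependent (K.indep ht) Finset.inter_subset_right hz₁ hy₁
      (h.symm.trans hy.symm) hut]
  · rw [if_neg hut, if_neg fun hut' => hut (Finset.mem_inter.1 hut').2]

/-! ### Pointed triangulations -/

namespace IsPointedTriangulation

variable {t : Finset E} {K : Geometry.SimplicialComplex ℝ E} {v : Set E → E} {F : Set E}

theorem subset_polytope (hK : IsPointedTriangulation (convexHull ℝ (t : Set E)) K v) {s : Finset E}
    (hs : s ∈ K.faces) : (s : Set E) ⊆ convexHull ℝ (t : Set E) :=
  hK.space_eq ▸ K.subset_space hs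

theorem convex_of_isFace (hF : IsFace (convexHull ℝ (t : Set E)) F) : Convex ℝ F :=
  hF.convex (convex_convexHull ℝ _)

/-- A simplex with vertices in a `k`-face is contained in a `k`-simplex in this face. -/
theorem exists_superset (hK : IsPointedTriangulation (convexHull ℝ (t : Set E)) K v)
    (hF : IsFace (convexHull ℝ (t : Set E)) F) {s : Finset E} (hs : s ∈ K.faces)
    (hsF : (s : Set E) ⊆ F) : ∃ r ∈ simplicesIn K F (dim F), s ⊆ r :=
  hK.pure_face F hF s hs (convexHull_min hsF (convex_of_isFace hF))

/-- Every point of a `k`-face lies in a `k`-simplex in this face. -/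
theorem exists_simplex (hK : IsPointedTriangulation (convexHull ℝ (t : Set E)) K v)
    (hF : IsFace (convexHull ℝ (t : Set E)) F) {x : E} (hx : x ∈ F) :
    ∃ s ∈ simplicesIn K F (dim F), x ∈ convexHull ℝ (s : Set E) := by
  classical
  have hxs : x ∈ K.space := hK.space_eq ▸ hF.subset hx
  obtain ⟨s, hs, hxs⟩ := Geometry.SimplicialComplex.mem_space_iff.1 hxs
  obtain ⟨w, hw₀, hw₁, hwx⟩ := Finset.mem_convexHull'.1 hxs
  -- Dropping the vertices of zero weight leaves a face of `s` whose vertices all lie in `F`, to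
  -- which purity applies.
  have hsum₁ : ∑ u ∈ s with w u ≠ 0, w u = 1 := by
    rw [Finset.sum_filter_of_ne (fun u _ h => h), hw₁]
  have hsum : ∑ u ∈ s with w u ≠ 0, w u • u = x := by
    rw [Finset.sum_filter_of_ne (p := fun u => w u ≠ 0)
      (fun u _ h h0 => h (by rw [h0, zero_smul])), hwx]
  have hne : (s.filter fun u => w u ≠ 0).Nonempty := by
    rw [Finset.nonempty_iff_ne_empty]
    intro h
    rw [h] at hsum₁
    simp at hsum₁
  obtain ⟨r, hr, hsr⟩ := hK.exists_superset hF (K.down_closed hs (Finset.filter_subset _ _) hne)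
    (fun u hu => by
      rw [Finset.mem_coe, Finset.mem_filter] at hu
      exact hF.mem_of_sum_mem (hK.subset_polytope hs) hw₀ hw₁ (hwx ▸ hx) hu.1 hu.2)
  refine ⟨r, hr, convexHull_mono (Finset.coe_subset.2 hsr) (Finset.mem_convexHull'.2
    ⟨w, fun u hu => hw₀ u (Finset.mem_filter.1 hu).1, hsum₁, hsum⟩)⟩

/-- The apex of a `k`-face is a vertex of every `k`-simplex in this face. -/
theorem apex_mem_simplex (hK : IsPointedTriangulation (convexHull ℝ (t : Set E)) K v)
    (hF : IsFace (convexHull ℝ (t : Set E)) F) {s : Finset E} (hs : s ∈ simplicesIn K F (dim F)) :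
    v F ∈ s := by
  obtain ⟨w, hw₀, hw₁, hwx⟩ := Finset.mem_convexHull'.1 (hK.apex_mem F hF s hs)
  -- As `{v F}` is a face, every vertex of `s` with nonzero weight in the apex equals the apex.
  have hvF : IsFace F {v F} := hK.apex_vert F hF
  obtain ⟨u, hu, hwu⟩ : ∃ u ∈ s, w u ≠ 0 := by
    by_contra! hc
    rw [Finset.sum_eq_zero hc] at hw₁
    exact zero_ne_one hw₁
  have := hvF.mem_of_sum_mem ((subset_convexHull ℝ _).trans hs.2.1) hw₀ hw₁ hwx hu hwu
  rw [Set.mem_singleton_iff] at this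
  exact this ▸ hu

theorem apex_mem_face (hK : IsPointedTriangulation (convexHull ℝ (t : Set E)) K v)
    (hF : IsFace (convexHull ℝ (t : Set E)) F) : v F ∈ F :=
  IsFace.subset (hK.apex_vert F hF) rfl

/-- A simplex in `F` that does not contain the apex of `F` lies in a proper face of `F`. -/
theorem exists_isProperFace [FiniteDimensional ℝ E]
    (hK : IsPointedTriangulation (convexHull ℝ (t : Set E)) K v)
    (hF : IsFace (convexHull ℝ (t : Set E)) F) {s : Finset E} (hs : s ∈ K.faces)
    (hsF : (s : Set E) ⊆ F) (hv : v F ∉ s) : ∃ G, IsProperFace F G ∧ (s : Set E) ⊆ G := by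
  classical
  have hne := Geometry.SimplicialComplex.nonempty_of_mem_faces hs
  have hc : (s.card : ℝ) ≠ 0 := by simpa using hne.ne_empty
  set x := ∑ u ∈ s, (s.card : ℝ)⁻¹ • u with hx
  by_contra! hno
  have hxF : x ∈ F := convexHull_min hsF (convex_of_isFace hF) (centroid_mem_convexHull hne)
  -- Prolong the segment from `v F` through the centroid `x` to a point `y` of `F`. A top simplex
  -- `r` containing `y` also contains `v F`, so `x` has positive weight at `v F` in `r`; uniqueness
  -- of coordinates then forces `v F ∈ s`.
  obtain ⟨ε, hε, hyF⟩ := exists_prolongation (convex_of_isFace hF) hxF (hK.apex_mem_face hF)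
    fun G hG hxG => hno G hG (hG.1.subset_of_centroid_mem hsF hne hxG)
  obtain ⟨r, hr, hyr⟩ := hK.exists_simplex hF hyF
  have hvr := hK.apex_mem_simplex hF hr
  obtain ⟨w, hw₀, hw₁, hwy⟩ := Finset.mem_convexHull'.1 hyr
  -- These are the weights of `x = (1 + ε)⁻¹ • (y + ε • v F)`.
  set z : E → ℝ := fun u => (1 + ε)⁻¹ * (w u + if u = v F then ε else 0) with hz
  have hε1 : (1 + ε) ≠ 0 := by positivity
  have hz₀ : ∀ u ∈ r, 0 ≤ z u := fun u hu => by
    have := hw₀ u hu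
    simp only [hz]
    split_ifs <;> positivity
  have hz₁ : ∑ u ∈ r, z u = 1 := by
    simp only [hz, ← Finset.mul_sum, Finset.sum_add_distrib, hw₁, Finset.sum_ite_eq', hvr, if_true]
    exact inv_mul_cancel₀ hε1
  have hzx : ∑ u ∈ r, z u • u = x := by
    simp only [hz, mul_smul, ← Finset.smul_sum, add_smul, Finset.sum_add_distrib, hwy, ite_smul,
      zero_smul, Finset.sum_ite_eq', hvr, if_true]
    rw [inv_smul_eq_iff₀ hε1]
    module
  have h := weight_eq_of_mem_faces hr.1 hs hz₀ hz₁ (w := z) (z := fun _ => (s.card : ℝ)⁻¹)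
    (fun _ _ => by positivity) (by simp [hc]) (hzx.trans hx) hvr
  rw [if_neg hv] at h
  have : 0 < z (v F) := by
    have := hw₀ _ hvr
    simp only [hz, if_true]
    positivity
  exact this.ne' h

end IsPointedTriangulation

/-- Among the faces of a polytope that contain a given set, there is a minimal one. -/
theorem exists_minimal_face [FiniteDimensional ℝ E] {t : Finset E} {A F : Set E}
    (hF : IsFace (convexHull ℝ (t : Set E)) F) (hA : A ⊆ F) :
    ∃ G, IsFace F G ∧ A ⊆ G ∧ ∀ H, IsProperFace G H → ¬ A ⊆ H := by
  induction h : dim F using Nat.strong_induction_on generalizing F with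
  | _ k ih =>
    by_cases hmin : ∀ H, IsProperFace F H → ¬ A ⊆ H
    · exact ⟨F, .refl hF.1, hA, hmin⟩
    · push Not at hmin
      obtain ⟨H, hH, hAH⟩ := hmin
      obtain ⟨G, hG, hAG, hGmin⟩ := ih _ (h ▸ hH.dim_lt) (hF.trans hH.1) hAH rfl
      refine ⟨G, ?_, hAG, hGmin⟩
      exact ((hF.trans hH.1).trans hG).mono hF.subset (hG.subset.trans hH.1.subset)

/-- The minimal face containing a given nonempty set is unique. -/
theorem minimal_face_unique {P A G H : Set E} (hA : A.Nonempty) (hG : IsFace P G) (hH : IsFace P H)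
    (hAG : A ⊆ G) (hAH : A ⊆ H) (hGmin : ∀ H, IsProperFace G H → ¬ A ⊆ H)
    (hHmin : ∀ G, IsProperFace H G → ¬ A ⊆ G) : G = H := by
  have hAGH : A ⊆ G ∩ H := Set.subset_inter hAG hAH
  have hGH := hG.inter hH (hA.mono hAGH)
  have h1 : G ∩ H = G := by
    by_contra hne
    exact hGmin _ ⟨hGH.mono hG.subset Set.inter_subset_left, hne⟩ hAGH
  have h2 : G ∩ H = H := by
    by_contra hne
    exact hHmin _ ⟨hGH.mono hH.subset Set.inter_subset_right, hne⟩ hAGH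
  exact h1.symm.trans h2

/-! ### Multisets supported on a simplex -/

/-- The multisets with `m` elements supported on a simplex of `K` with vertices in `F`. -/
def supported (K : Geometry.SimplicialComplex ℝ E) (F : Set E) (m : ℕ) : Set (Multiset E) :=
  {x | x.card = m ∧ ∃ s ∈ K.faces, (s : Set E) ⊆ F ∧ ∀ u ∈ x, u ∈ s}

/-- The multisets supported on a simplex in `F`, but not on a simplex in a proper face of `F`. -/
def innerSupported (K : Geometry.SimplicialComplex ℝ E) (F : Set E) (m : ℕ) : Set (Multiset E) :=
  {x | x ∈ supported K F m ∧ ∀ G, IsProperFace F G → x ∉ supported K G m}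

theorem supported_mono {K : Geometry.SimplicialComplex ℝ E} {F G : Set E} (h : F ⊆ G) (m : ℕ) :
    supported K F m ⊆ supported K G m := fun _ hx =>
  ⟨hx.1, hx.2.imp fun _ hs => ⟨hs.1, hs.2.1.trans h, hs.2.2⟩⟩

theorem finite_setOf_card_eq {α : Type*} (s : Finset α) (m : ℕ) :
    {x : Multiset α | x.card = m ∧ ∀ u ∈ x, u ∈ s}.Finite := by
  classical
  refine (Multiset.toFinset (Multiset.powerset (m • s.val))).finite_toSet.subset fun x hx => ?_
  rw [Finset.mem_coe, Multiset.mem_toFinset, Multiset.mem_powerset, Multiset.le_iff_count]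
  intro u
  by_cases hu : u ∈ x
  · rw [Multiset.count_nsmul, Multiset.count_eq_one_of_mem s.nodup (hx.2 u hu), mul_one]
    exact hx.1 ▸ Multiset.count_le_card u x
  · simp [Multiset.count_eq_zero_of_notMem hu]

theorem finite_supported {K : Geometry.SimplicialComplex ℝ E} (hK : K.faces.Finite) (F : Set E)
    (m : ℕ) : (supported K F m).Finite := by
  refine (hK.biUnion fun s _ => finite_setOf_card_eq s m).subset fun x hx => ?_
  obtain ⟨hm, s, hs, -, hxs⟩ := hx
  exact Set.mem_biUnion hs ⟨hm, hxs⟩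

theorem finite_innerSupported {K : Geometry.SimplicialComplex ℝ E} (hK : K.faces.Finite)
    (F : Set E) (m : ℕ) : (innerSupported K F m).Finite :=
  (finite_supported hK F m).subset fun _ hx => hx.1

/-- By down-closure the support itself serves as the simplex. Positive size matters, since the empty
set is not a face of `K`. -/
theorem mem_supported_succ [DecidableEq E] {K : Geometry.SimplicialComplex ℝ E} {F : Set E} {m : ℕ}
    {x : Multiset E} : x ∈ supported K F (m + 1) ↔
      x.card = m + 1 ∧ x.toFinset ∈ K.faces ∧ (x.toFinset : Set E) ⊆ F := by
  refine and_congr_right fun hm => ⟨?_, fun h => ⟨_, h.1, h.2, fun u hu => by simpa using hu⟩⟩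
  rintro ⟨s, hs, hsF, hxs⟩
  have hsub : x.toFinset ⊆ s := fun u hu => hxs u (Multiset.mem_toFinset.1 hu)
  refine ⟨K.down_closed hs hsub ?_, fun u hu => hsF (hsub hu)⟩
  rw [Multiset.toFinset_nonempty]
  rintro rfl
  simp at hm

theorem supported_zero {K : Geometry.SimplicialComplex ℝ E} {F : Set E}
    (h : ∃ s ∈ K.faces, (s : Set E) ⊆ F) : supported K F 0 = {0} := by
  ext x
  rw [Set.mem_singleton_iff]
  refine ⟨fun hx => Multiset.card_eq_zero.1 hx.1, ?_⟩
  rintro rfl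
  obtain ⟨s, hs, hsF⟩ := h
  exact ⟨rfl, s, hs, hsF, by simp⟩

theorem natCast_finsum {ι : Type*} [Finite ι] (f : ι → ℕ) :
    ((∑ᶠ i, f i : ℕ) : ℤ) = ∑ᶠ i, (f i : ℤ) := by
  cases nonempty_fintype ι
  rw [finsum_eq_sum_of_fintype, finsum_eq_sum_of_fintype]
  push_cast
  rfl

-- Counting multisets face by face

namespace IsPointedTriangulation

variable {t : Finset E} {K : Geometry.SimplicialComplex ℝ E} {v : Set E → E} {F : Set E}

theorem exists_face_subset (hK : IsPointedTriangulation (convexHull ℝ (t : Set E)) K v)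
    (hF : IsFace (convexHull ℝ (t : Set E)) F) : ∃ s ∈ K.faces, (s : Set E) ⊆ F := by
  obtain ⟨x, hx⟩ := hF.1
  obtain ⟨s, hs, -⟩ := hK.exists_simplex hF hx
  exact ⟨s, hs.1, (subset_convexHull ℝ _).trans hs.2.1⟩

theorem finite_faces_of_face (hF : IsFace (convexHull ℝ (t : Set E)) F) :
    {G | IsFace F G}.Finite :=
  (finite_setOf_isFace t).subset fun _ hG => hF.trans hG

/-- Distinct faces have disjoint sets of inner multisets. -/
theorem eq_of_mem_innerSupported {G H : Set E} (hG : IsFace (convexHull ℝ (t : Set E)) G)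
    (hH : IsFace (convexHull ℝ (t : Set E)) H) {m : ℕ} {x : Multiset E}
    (hxG : x ∈ innerSupported K G (m + 1)) (hxH : x ∈ innerSupported K H (m + 1)) : G = H := by
  classical
  have h1 := mem_supported_succ.1 hxG.1
  have h2 := mem_supported_succ.1 hxH.1
  refine minimal_face_unique (Finset.coe_nonempty.2
    (Geometry.SimplicialComplex.nonempty_of_mem_faces h1.2.1)) hG hH h1.2.2 h2.2.2 ?_ ?_
  · exact fun F hF hxF => hxG.2 F hF (mem_supported_succ.2 ⟨h1.1, h1.2.1, hxF⟩)
  · exact fun F hF hxF => hxH.2 F hF (mem_supported_succ.2 ⟨h1.1, h1.2.1, hxF⟩)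

theorem ncard_iUnion_innerSupported (hK : IsPointedTriangulation (convexHull ℝ (t : Set E)) K v)
    (hF : IsFace (convexHull ℝ (t : Set E)) F) (p : Set E → Prop) (hp : ∀ G, p G → IsFace F G)
    (m : ℕ) :
    ((⋃ G : {G // p G}, innerSupported K G.1 (m + 1)).ncard : ℤ) =
      ∑ᶠ G : {G // p G}, ((innerSupported K G.1 (m + 1)).ncard : ℤ) := by
  have : Finite {G // p G} := ((finite_faces_of_face hF).subset hp).to_subtype
  rw [Set.ncard_iUnion_of_finite (fun G => finite_innerSupported hK.finite_faces _ _),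
    natCast_finsum]
  intro G H hGH
  refine Set.disjoint_left.2 fun x hxG hxH => hGH (Subtype.ext ?_)
  exact eq_of_mem_innerSupported (hF.trans (hp _ G.2)) (hF.trans (hp _ H.2)) hxG hxH

/-- The empty multiset is already supported in the proper face `{v F}`. This matches the initial
value `0` of the interior numbers at `n = 1`. -/
theorem innerSupported_zero (hK : IsPointedTriangulation (convexHull ℝ (t : Set E)) K v)
    (hF : IsFace (convexHull ℝ (t : Set E)) F) (h : dim F ≠ 0) : innerSupported K F 0 = ∅ := by
  have hv : IsFace F {v F} := hK.apex_vert F hF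
  have hvF : IsProperFace F {v F} := ⟨hv, fun heq => h (by rw [← heq]; simp [dim])⟩
  refine Set.eq_empty_of_forall_notMem fun x hx => hx.2 _ hvF ?_
  rw [supported_zero (hK.exists_face_subset (hF.trans hv)), Set.mem_singleton_iff]
  exact Multiset.card_eq_zero.1 hx.1.1

variable [FiniteDimensional ℝ E]

theorem exists_mem_innerSupported
    (hF : IsFace (convexHull ℝ (t : Set E)) F) {m : ℕ} {x : Multiset E}
    (hx : x ∈ supported K F (m + 1)) : ∃ G, IsFace F G ∧ x ∈ innerSupported K G (m + 1) := by
  classical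
  have h := mem_supported_succ.1 hx
  obtain ⟨G, hG, hxG, hmin⟩ := exists_minimal_face hF h.2.2
  exact ⟨G, hG, mem_supported_succ.2 ⟨h.1, h.2.1, hxG⟩,
    fun H hH hxH => hmin H hH (mem_supported_succ.1 hxH).2.2⟩

/-- The supported multisets in `F` are partitioned by the faces of `F`. -/
theorem ncard_innerSupported_succ (hK : IsPointedTriangulation (convexHull ℝ (t : Set E)) K v)
    (hF : IsFace (convexHull ℝ (t : Set E)) F) (m : ℕ) :
    ((innerSupported K F (m + 1)).ncard : ℤ) = (supported K F (m + 1)).ncard -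
      ∑ᶠ G : {G // IsProperFace F G}, ((innerSupported K G.1 (m + 1)).ncard : ℤ) := by
  have hunion : supported K F (m + 1) = innerSupported K F (m + 1) ∪
      ⋃ G : {G // IsProperFace F G}, innerSupported K G.1 (m + 1) := by
    refine Set.Subset.antisymm (fun x hx => ?_) (Set.union_subset (fun x hx => hx.1)
      (Set.iUnion_subset fun G x hx => supported_mono G.2.1.subset _ hx.1))
    obtain ⟨G, hG, hxG⟩ := exists_mem_innerSupported hF hx
    by_cases hGF : G = F
    · exact Or.inl (hGF ▸ hxG)
    · exact Or.inr (Set.mem_iUnion.2 ⟨⟨G, hG, hGF⟩, hxG⟩)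
  have hdisj : Disjoint (innerSupported K F (m + 1))
      (⋃ G : {G // IsProperFace F G}, innerSupported K G.1 (m + 1)) := by
    refine Set.disjoint_left.2 fun x hx hx' => ?_
    obtain ⟨G, hG⟩ := Set.mem_iUnion.1 hx'
    exact hx.2 G.1 G.2 hG.1
  rw [← hK.ncard_iUnion_innerSupported hF _ (fun G hG => hG.1), hunion,
    Set.ncard_union_eq hdisj (finite_innerSupported hK.finite_faces _ _)
      ((finite_supported hK.finite_faces F (m + 1)).subset (by
        rw [hunion]; exact Set.subset_union_right))]
  push_cast
  ring

/-- Multisets supported in `F` either contain the apex of `F`, or are inner multisets of a face that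
avoids the apex. -/
theorem ncard_supported_succ (hK : IsPointedTriangulation (convexHull ℝ (t : Set E)) K v)
    (hF : IsFace (convexHull ℝ (t : Set E)) F) (m : ℕ) :
    ((supported K F (m + 1)).ncard : ℤ) = (supported K F m).ncard +
      ∑ᶠ G : {G // IsProperFace F G ∧ v F ∉ G}, ((innerSupported K G.1 (m + 1)).ncard : ℤ) := by
  classical
  have hunion : supported K F (m + 1) = Multiset.cons (v F) '' supported K F m ∪
      ⋃ G : {G // IsProperFace F G ∧ v F ∉ G}, innerSupported K G.1 (m + 1) := by
    refine Set.Subset.antisymm (fun x hx => ?_) (Set.union_subset ?_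
      (Set.iUnion_subset fun G x hx => supported_mono G.2.1.1.subset _ hx.1))
    · by_cases hv : v F ∈ x
      · obtain ⟨y, rfl⟩ := Multiset.exists_cons_of_mem hv
        obtain ⟨hm, s, hs, hsF, hxs⟩ := hx
        refine Or.inl ⟨y, ⟨by simpa using hm, s, hs, hsF, fun u hu => hxs u ?_⟩, rfl⟩
        exact Multiset.mem_cons_of_mem hu
      · obtain ⟨G, hG, hxG⟩ := exists_mem_innerSupported hF hx
        have hGP := hF.trans hG
        have hvG : v F ∉ G := by
          intro hvG
          -- Both apexes lie in `F ∩ G = G`, so the compatibility of apexes applies.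
          have hvv : v F = v G := hK.apex_eq F G hF hGP (by
            rintro _ (rfl | rfl)
            · exact ⟨hK.apex_mem_face hF, hvG⟩
            · exact ⟨hG.subset (hK.apex_mem_face hGP), hK.apex_mem_face hGP⟩)
          have h := mem_supported_succ.1 hxG.1
          obtain ⟨H, hH, hxH⟩ := hK.exists_isProperFace hGP h.2.1 h.2.2
            (by rwa [Multiset.mem_toFinset, ← hvv])
          exact hxG.2 H hH (mem_supported_succ.2 ⟨h.1, h.2.1, hxH⟩)
        refine Or.inr (Set.mem_iUnion.2 ⟨⟨G, ⟨hG, ?_⟩, hvG⟩, hxG⟩)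
        rintro rfl
        exact hvG (hK.apex_mem_face hF)
    · rintro _ ⟨y, ⟨hm, s, hs, hsF, hys⟩, rfl⟩
      obtain ⟨r, hr, hsr⟩ := hK.exists_superset hF hs hsF
      refine ⟨by simp [hm], r, hr.1, (subset_convexHull ℝ _).trans hr.2.1, fun u hu => ?_⟩
      rcases Multiset.mem_cons.1 hu with rfl | hu
      · exact hK.apex_mem_simplex hF hr
      · exact hsr (hys u hu)
  have hdisj : Disjoint (Multiset.cons (v F) '' supported K F m)
      (⋃ G : {G // IsProperFace F G ∧ v F ∉ G}, innerSupported K G.1 (m + 1)) := by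
    refine Set.disjoint_left.2 ?_
    rintro _ ⟨y, -, rfl⟩ hx'
    obtain ⟨G, hG⟩ := Set.mem_iUnion.1 hx'
    exact G.2.2 ((mem_supported_succ.1 hG.1).2.2 (by simp))
  rw [← hK.ncard_iUnion_innerSupported hF _ (fun G hG => hG.1.1), hunion,
    Set.ncard_union_eq hdisj ((finite_supported hK.finite_faces F m).image _)
      ((finite_supported hK.finite_faces F (m + 1)).subset (by
        rw [hunion]; exact Set.subset_union_right)),
    Set.ncard_image_of_injective _ (fun a b h => (Multiset.cons_inj_right _).1 h)]
  push_cast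
  rfl

/-- A face of dimension zero has no proper faces. -/
theorem not_isProperFace_of_dim_eq_zero (h : dim F = 0) (G : Set E) : ¬ IsProperFace F G :=
  fun hG => by
    have := hG.dim_lt
    omega

theorem ncard_supported_of_dim_eq_zero
    (hK : IsPointedTriangulation (convexHull ℝ (t : Set E)) K v)
    (hF : IsFace (convexHull ℝ (t : Set E)) F) (h : dim F = 0) (m : ℕ) :
    (supported K F m).ncard = 1 := by
  induction m with
  | zero => rw [supported_zero (hK.exists_face_subset hF), Set.ncard_singleton]
  | succ m ih =>
    have : IsEmpty {G // IsProperFace F G ∧ v F ∉ G} :=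
      ⟨fun G => not_isProperFace_of_dim_eq_zero h _ G.2.1⟩
    have h1 := hK.ncard_supported_succ hF m
    rw [finsum_of_isEmpty, ih] at h1
    exact_mod_cast h1

theorem innerSupported_of_dim_eq_zero (h : dim F = 0) (m : ℕ) :
    innerSupported K F m = supported K F m :=
  Set.Subset.antisymm (fun _ hx => hx.1) fun _ hx =>
    ⟨hx, fun G hG => (not_isProperFace_of_dim_eq_zero h G hG).elim⟩

/-- The polytope numbers and the interior polytope numbers of a face count multisets. -/
theorem numbers_eq_ncard (hK : IsPointedTriangulation (convexHull ℝ (t : Set E)) K v)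
    (hF : IsFace (convexHull ℝ (t : Set E)) F) (m : ℕ) :
    polytopeNumber v F (m + 1) = (supported K F m).ncard ∧
      interiorPolytopeNumber v F (m + 1) = (innerSupported K F m).ncard := by
  induction h : dim F using Nat.strong_induction_on generalizing F m with
  | _ k ih =>
    by_cases hd : dim F = 0
    · rw [innerSupported_of_dim_eq_zero hd, hK.ncard_supported_of_dim_eq_zero hF hd]
      cases m <;> simp [polytopeNumber, interiorPolytopeNumber, hd]
    have hproper : ∀ G, IsProperFace F G → ∀ m,
        interiorPolytopeNumber v G (m + 1) = (innerSupported K G m).ncard :=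
      fun G hG m => (ih _ (h ▸ hG.dim_lt) (hF.trans hG.1) m rfl).2
    have hnum : ∀ m, polytopeNumber v F (m + 1) = (supported K F m).ncard := by
      intro m
      induction m with
      | zero => simp [polytopeNumber, supported_zero (hK.exists_face_subset hF)]
      | succ m ihm =>
        rw [polytopeNumber, if_neg hd, ihm, hK.ncard_supported_succ hF]
        congr 1
        exact finsum_congr fun G => hproper G.1 G.2.1 _
    refine ⟨hnum m, ?_⟩
    cases m with
    | zero => simp [interiorPolytopeNumber, hd, hK.innerSupported_zero hF hd]
    | succ m =>
      rw [interiorPolytopeNumber, if_neg hd, hnum, hK.ncard_innerSupported_succ hF]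
      congr 1
      exact finsum_congr fun G => hproper G.1 G.2 _

end IsPointedTriangulation

/-! ### Point sets of simplices -/

/-- A coordinate vector on `s` is the multiplicity function of a multiset; the shift `n = m + 1`
turns `n - 1` into its size. -/
theorem pointSet_succ (s : Finset E) (m : ℕ) :
    pointSet s (m + 1) = Multiset.sum '' {x : Multiset E | x.card = m ∧ ∀ u ∈ x, u ∈ s} := by
  classical
  ext p
  constructor
  · rintro ⟨f, hf, rfl⟩
    have hf' : ∑ i, f i = m := by
      have h : ((∑ i, f i : ℕ) : ℤ) = ((m + 1 : ℕ) : ℤ) - 1 := hf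
      omega
    refine ⟨∑ u, f u • ({(u : E)} : Multiset E), ⟨by simpa using hf', fun u hu => ?_⟩, ?_⟩
    · obtain ⟨i, -, hi⟩ := Multiset.mem_sum.1 hu
      rw [Multiset.mem_singleton.1 (Multiset.mem_of_mem_nsmul hi)]
      exact i.2
    · rw [← Multiset.coe_sumAddMonoidHom, map_sum]
      simp [Nat.cast_smul_eq_nsmul, Multiset.sum_nsmul]
  · rintro ⟨x, ⟨hm, hx⟩, rfl⟩
    have hsub : x.toFinset ⊆ s := fun u hu => hx u (Multiset.mem_toFinset.1 hu)
    refine ⟨fun u => x.count (u : E), ?_, ?_⟩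
    · have : ∑ u : s, x.count (u : E) = m := by
        rw [Finset.sum_coe_sort s fun u => x.count u, Multiset.sum_count_eq_card hx, hm]
      change ((∑ u : s, x.count (u : E) : ℕ) : ℤ) = ((m + 1 : ℕ) : ℤ) - 1
      rw [this]
      push_cast
      ring
    · simp only [Nat.cast_smul_eq_nsmul]
      rw [Finset.sum_coe_sort s fun u => x.count u • u]
      exact (Finset.sum_multiset_count_of_subset x s hsub).symm

/-- A multiset supported on a simplex of the complex is determined by its size and its sum. -/
theorem sum_injOn_supported (K : Geometry.SimplicialComplex ℝ E) (F : Set E) (m : ℕ) :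
    Set.InjOn Multiset.sum (supported K F m) := by
  classical
  have hcount : ∀ {x : Multiset E} {s : Finset E}, x.card = m → m ≠ 0 → (∀ u ∈ x, u ∈ s) →
      ∑ u ∈ s, (x.count u : ℝ) / m = 1 ∧ ∑ u ∈ s, ((x.count u : ℝ) / m) • u = (m : ℝ)⁻¹ • x.sum := by
    intro x s hx hm hxs
    have hm' : (m : ℝ) ≠ 0 := by exact_mod_cast hm
    constructor
    · rw [← Finset.sum_div, ← Nat.cast_sum, Multiset.sum_count_eq_card hxs, hx, div_self hm']
    · rw [Finset.sum_multiset_count_of_subset x s fun u hu => hxs u (Multiset.mem_toFinset.1 hu),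
        Finset.smul_sum]
      refine Finset.sum_congr rfl fun u _ => ?_
      rw [div_eq_inv_mul, mul_smul, Nat.cast_smul_eq_nsmul]
  have hle : ∀ {x y : Multiset E}, x ∈ supported K F m → y ∈ supported K F m → x.sum = y.sum →
      x ≤ y := by
    rintro x y ⟨hx, s, hs, -, hxs⟩ ⟨hy, r, hr, -, hyr⟩ hxy
    -- Size zero is separate because the coordinates are multiplicities divided by `m`.
    rcases Nat.eq_zero_or_pos m with rfl | hm
    · rw [Multiset.card_eq_zero.1 hx]
      exact Multiset.zero_le y
    have hm' : (0 : ℝ) < m := by exact_mod_cast hm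
    obtain ⟨hx₁, hx₂⟩ := hcount hx hm.ne' hxs
    obtain ⟨hy₁, hy₂⟩ := hcount hy hm.ne' hyr
    refine Multiset.le_iff_count.2 fun u => ?_
    by_cases hu : u ∈ x
    · have h := weight_eq_of_mem_faces hs hr (fun u _ => by positivity) hx₁
        (fun u _ => by positivity) hy₁ (by rw [hx₂, hy₂, hxy]) (hxs u hu)
      have h' : (x.count u : ℝ) / m ≤ (y.count u : ℝ) / m := by
        rw [h]
        split_ifs
        · exact le_rfl
        · positivity
      rw [div_le_div_iff_of_pos_right hm'] at h'
      exact_mod_cast h'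
    · simp [Multiset.count_eq_zero_of_notMem hu]
  exact fun x hx y hy hxy => le_antisymm (hle hx hy hxy) (hle hy hx hxy.symm)

theorem unionPoints_zero (d : ℕ) (K : Geometry.SimplicialComplex ℝ E) : unionPoints d K 0 = ∅ := by
  simp only [unionPoints, pointSet, standardPoints, Set.iUnion_eq_empty, Set.image_eq_empty]
  refine fun s _ => Set.eq_empty_of_forall_notMem fun x hx => ?_
  have h : ((∑ i, x i : ℕ) : ℤ) = ((0 : ℕ) : ℤ) - 1 := hx
  have := Int.natCast_nonneg (∑ i, x i)
  rw [h] at this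
  norm_num at this

namespace IsPointedTriangulation

variable {t : Finset E} {K : Geometry.SimplicialComplex ℝ E} {v : Set E → E}

theorem unionPoints_succ (hK : IsPointedTriangulation (convexHull ℝ (t : Set E)) K v)
    (hP : IsFace (convexHull ℝ (t : Set E)) (convexHull ℝ (t : Set E))) (m : ℕ) :
    unionPoints (dim (convexHull ℝ (t : Set E))) K (m + 1) =
      Multiset.sum '' supported K (convexHull ℝ (t : Set E)) m := by
  ext p
  simp only [unionPoints, pointSet_succ, Set.mem_iUnion, exists_prop]
  constructor
  · rintro ⟨s, ⟨hs, -⟩, x, ⟨hx, hxs⟩, rfl⟩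
    exact ⟨x, ⟨hx, s, hs, hK.subset_polytope hs, hxs⟩, rfl⟩
  · rintro ⟨x, ⟨hx, s, hs, hsP, hxs⟩, rfl⟩
    obtain ⟨r, hr, hsr⟩ := hK.exists_superset hP hs hsP
    exact ⟨r, ⟨hr.1, hr.2.2⟩, x, ⟨hx, fun u hu => hsr (hxs u hu)⟩, rfl⟩

/-- A simplex in the boundary lies in a single proper face, namely one containing its centroid.
Conversely, a proper face sits in a facet, where purity enlarges the simplex to dimension `d - 1`.
-/
theorem boundaryPoints_succ [FiniteDimensional ℝ E]
    (hK : IsPointedTriangulation (convexHull ℝ (t : Set E)) K v) (m : ℕ) :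
    boundaryPoints (dim (convexHull ℝ (t : Set E))) (convexHull ℝ (t : Set E)) K (m + 1) =
      Multiset.sum '' {x | ∃ G, IsProperFace (convexHull ℝ (t : Set E)) G ∧
        x ∈ supported K G m} := by
  ext p
  simp only [boundaryPoints, pointSet_succ, Set.mem_iUnion, exists_prop]
  constructor
  · rintro ⟨s, ⟨hs, -, hsb⟩, x, ⟨hx, hxs⟩, rfl⟩
    have hne := Geometry.SimplicialComplex.nonempty_of_mem_faces hs
    obtain ⟨-, G, hG, hcG⟩ := hsb (centroid_mem_convexHull hne)
    exact ⟨x, ⟨G, hG, hx, s, hs,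
      hG.1.subset_of_centroid_mem (hK.subset_polytope hs) hne hcG, hxs⟩, rfl⟩
  · rintro ⟨x, ⟨F, hF, hx, s, hs, hsF, hxs⟩, rfl⟩
    obtain ⟨G, hG, hFG, hd⟩ := hF.exists_facet
    obtain ⟨r, hr, hsr⟩ := hK.exists_superset hG.1 hs (hsF.trans hFG)
    exact ⟨r, ⟨hr.1, hr.2.2.trans hd, fun y hy => ⟨hG.1.subset (hr.2.1 hy), G, hG, hr.2.1 hy⟩⟩, x,
      ⟨hx, fun u hu => hsr (hxs u hu)⟩, rfl⟩

end IsPointedTriangulation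

end PolytopeNumbers

end

theorem mainTheorem4 {E : Type*} [NormedAddCommGroup E] [NormedSpace ℝ E] [FiniteDimensional ℝ E]
    (d : ℕ) (P : Set E) (hP : PolytopeNumbers.IsPolytope d P)
    (K : Geometry.SimplicialComplex ℝ E) (v : Set E → E)
    (hK : PolytopeNumbers.IsPointedTriangulation P K v) (n : ℕ) :
    (PolytopeNumbers.unionPoints d K n).Finite ∧
    PolytopeNumbers.polytopeNumber v P n = ((PolytopeNumbers.unionPoints d K n).ncard : ℤ) ∧
    PolytopeNumbers.interiorPolytopeNumber v P n =
      ((PolytopeNumbers.unionPoints d K n \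
        PolytopeNumbers.boundaryPoints d P K n).ncard : ℤ) := by
  open PolytopeNumbers in
  obtain ⟨⟨t, ht, rfl⟩, rfl⟩ := hP
  have hface : IsFace (convexHull ℝ (t : Set E)) (convexHull ℝ (t : Set E)) :=
    .refl (convexHull_nonempty_iff.2 (Finset.coe_nonempty.2 ht))
  cases n with
  | zero => simp [unionPoints_zero, polytopeNumber, interiorPolytopeNumber]
  | succ m =>
    have hinj := sum_injOn_supported K (convexHull ℝ (t : Set E)) m
    have hsub : {x | ∃ G, IsProperFace (convexHull ℝ (t : Set E)) G ∧ x ∈ supported K G m} ⊆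
        supported K (convexHull ℝ (t : Set E)) m :=
      fun x ⟨G, hG, hx⟩ => supported_mono hG.1.subset m hx
    have hdiff : supported K (convexHull ℝ (t : Set E)) m \
        {x | ∃ G, IsProperFace (convexHull ℝ (t : Set E)) G ∧ x ∈ supported K G m} =
        innerSupported K (convexHull ℝ (t : Set E)) m := by
      ext x
      simp [innerSupported]
    obtain ⟨hnum, hint⟩ := hK.numbers_eq_ncard hface m
    -- Injectivity of the sum lets the set difference and both cardinalities be computed on
    -- multisets.
    rw [hK.unionPoints_succ hface, hK.boundaryPoints_succ, ← hinj.image_sdiff_subset hsub, hdiff,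
      hinj.ncard_image, (hinj.mono fun x hx => hx.1).ncard_image]
    exact ⟨(finite_supported hK.finite_faces _ m).image _, hnum, hint⟩
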